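/- Let $f$ be a probability mass function on the non-negative integers that is regularly varying with exponent $\gamma>1$, i.e. $f(k)=l(k)\,k^{-\gamma-1}$ for all $k\ge 1$, where $l:\mathbb R\to\mathbb R$ is slowly varying ($\lim_{x\to\infty} l(\lambda x)/l(x)=1$ for every $\lambda>0$) and monotone on some half-line $[x_0,\infty)$. Let $f^*(k)=kf(k)/\sum_j jf(j)$ be its size-biased version. For a multigraph on nodes $1,\dots,n$ let $G_{ij}$ ($i\ne j$) be the number of edges between $i$ and $j$ and let $G_{ii}$ be twice the number of self-loops at $i$. Put $D_i=\sum_j G_{ij}$, $L_n=\sum_i D_i$, $f_n(k)=\frac1n\sum_i \mathbf 1\{D_i=k\}$, $f_n^*(k)=\frac1{L_n}\sum_{i,j} G_{ij}\mathbf 1\{D_i=k\}$, $F_n^*(\ell)=\frac1{L_n}\sum_i D_i\mathbf 1\{D_i\le \ell\}$ and $h_n(k,\ell)=\frac1{L_n}\sum_{i,j} G_{ij}\mathbf 1\{D_i=k,\,D_j=\ell\}$. The average nearest neighbor rank (ANNR) is $$\Theta_n(k)=\mathbf 1\{f_n(k)>0\}\,\frac{\sum_{\ell>0}h_n(k,\ell)F_n^*(\ell)}{f_n^*(k)}.$$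 For each $n$ let $G_n$ be generated by the configuration model with i.i.d. degrees: draw $D_1,\dots,D_{n-1},d_n$ independently from $f$, put $D_n=d_n+1$ if $D_1+\dots+D_{n-1}+d_n$ is odd and $D_n=d_n$ otherwise, attach $D_i$ half-edges to node $i$, and pair all half-edges uniformly at random. Let $\widehat G_n$ be the erased configuration model (ECM), that is, the simple graph obtained from $G_n$ by removing all self-loops and replacing all multiple edges between two nodes by a single edge. Let $\Theta_n(k)$ and $\widehat\Theta_n(k)$ be the ANNR of $G_n$ and of $\widehat G_n$, where all quantities in $\widehat\Theta_n(k)$ are computed from $\widehat G_n$ (with its own degrees). Then for every $k$ with $f^*(k)>0$ and every $\delta>0$, $$\lim_{n\to\infty}\mathbb P\left(\left|\widehat\Theta_n(k)-\Theta_n(k)\right|>\delta\right)=0.$$ -/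

import Mathlib

open MeasureTheory ProbabilityTheory Filter Topology

noncomputable section

/-! ### Regularly varying distributions -/

/-- `l` is slowly varying at infinity. -/
def SlowlyVarying (l : ℝ → ℝ) : Prop :=
  ∀ c : ℝ, 0 < c → Tendsto (fun x => l (c * x) / l x) atTop (𝓝 1)

/-- `l` is monotone (in one of the two directions) on some half-line. -/
def EventuallyMonotone (l : ℝ → ℝ) : Prop :=
  ∃ x₀ : ℝ, MonotoneOn l (Set.Ici x₀) ∨ AntitoneOn l (Set.Ici x₀)

/-- The probability mass function `f` is regularly varying with exponent `γ`:
`f k = l k * k ^ (-γ - 1)` for all `k ≥ 1`, where `l` is slowly varying and eventually monotone. -/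
def RegularlyVarying (f : PMF ℕ) (γ : ℝ) : Prop :=
  ∃ l : ℝ → ℝ, SlowlyVarying l ∧ EventuallyMonotone l ∧
    ∀ k : ℕ, 1 ≤ k → (f k).toReal = l k * (k : ℝ) ^ (-γ - 1)

/-- The mean of `f`. -/
def pmfMean (f : PMF ℕ) : ℝ := ∑' k : ℕ, (k : ℝ) * (f k).toReal

/-- The size-biased probability mass function of `f`. -/
def sizeBiased (f : PMF ℕ) (k : ℕ) : ℝ := (k : ℝ) * (f k).toReal / pmfMean f

/-! ### Multigraphs and the average nearest neighbor rank -/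

/-- A multigraph on `n` nodes, recorded by the numbers `G i j` of directed edges `i → j`:
an undirected edge between `i ≠ j` contributes one to `G i j` and one to `G j i`, and a self-loop
at `i` contributes two to `G i i`. -/
abbrev Multigraph (n : ℕ) : Type := Fin n → Fin n → ℕ

namespace Multigraph

variable {n : ℕ}

/-- The degree of node `i`. -/
def degree (G : Multigraph n) (i : Fin n) : ℕ := ∑ j, G i j

/-- The sum of all degrees. -/
def totalDegree (G : Multigraph n) : ℕ := ∑ i, G.degree i

/-- The empirical degree density `f_n(k)`. -/
def degreeDensity (G : Multigraph n) (k : ℕ) : ℝ :=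
  (∑ i, if G.degree i = k then (1 : ℝ) else 0) / n

/-- The empirical size-biased degree density: the fraction of the directed edges `i → j` for which
`i` has degree `k`. -/
def sizeBiasedDensity (G : Multigraph n) (k : ℕ) : ℝ :=
  (∑ i, ∑ j, (G i j : ℝ) * if G.degree i = k then 1 else 0) / G.totalDegree

/-- The empirical size-biased cumulative degree distribution function. -/
def sizeBiasedCDF (G : Multigraph n) (l : ℕ) : ℝ :=
  (∑ i, (G.degree i : ℝ) * if G.degree i ≤ l then 1 else 0) / G.totalDegree

/-- The joint degree distribution: the fraction of the directed edges `i → j` for which `i` has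
degree `k` and `j` has degree `l`. -/
def jointDensity (G : Multigraph n) (k l : ℕ) : ℝ :=
  (∑ i, ∑ j, (G i j : ℝ) * if G.degree i = k ∧ G.degree j = l then 1 else 0) / G.totalDegree

/-- The average nearest neighbor rank of `G` at degree `k`. The sum over all `l > 0` is finite:
no degree exceeds the sum of all degrees, so the joint density vanishes for larger `l`. -/
def annr (G : Multigraph n) (k : ℕ) : ℝ :=
  (if 0 < G.degreeDensity k then 1 else 0) *
    ((∑ l ∈ Finset.Icc 1 G.totalDegree, G.jointDensity k l * G.sizeBiasedCDF l) /
      G.sizeBiasedDensity k)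

/-- Remove all self-loops and replace multiple edges by single ones. -/
def erase (G : Multigraph n) : Multigraph n :=
  fun i j => if i = j then 0 else min (G i j) 1

end Multigraph

/-! ### The configuration model -/

/-- The law of `n` independent samples from `f`. -/
def iidLaw (f : PMF ℕ) (n : ℕ) : PMF (Fin n → ℕ) :=
  (Measure.pi fun _ : Fin n => f.toMeasure).toPMF

/-- Add one to the last entry of `d` if the sum of all entries is odd. -/
def makeEven {n : ℕ} (d : Fin n → ℕ) (i : Fin n) : ℕ :=
  d i + if (i : ℕ) + 1 = n ∧ Odd (∑ j, d j) then 1 else 0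

/-- The stubs (half-edges) of a degree sequence: `d i` of them are attached to node `i`. -/
abbrev Stub {n : ℕ} (d : Fin n → ℕ) : Type := Σ i : Fin n, Fin (d i)

/-- A pairing of the stubs, as the map that sends each stub to its partner: an involution without
fixed points. -/
abbrev Pairing {n : ℕ} (d : Fin n → ℕ) : Type :=
  {σ : Equiv.Perm (Stub d) // ∀ s, σ (σ s) = s ∧ σ s ≠ s}

/-- The multigraph that results from a pairing of the stubs: `G i j` is the number of stubs at `i`
whose partner is a stub at `j`. -/
def Pairing.graph {n : ℕ} {d : Fin n → ℕ} (σ : Pairing d) : Multigraph n :=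
  fun i j => Fintype.card {s : Stub d // s.1 = i ∧ (σ.1 s).1 = j}

theorem even_sum_makeEven {n : ℕ} (d : Fin n → ℕ) : Even (∑ i, makeEven d i) := by
  by_cases h : Odd (∑ j, d j)
  · cases n with
    | zero => simp
    | succ m =>
      have e : ∑ i, makeEven d i = ∑ i, d i + 1 := by
        simp only [makeEven, Finset.sum_add_distrib]
        congr 1
        rw [Finset.sum_eq_single (Fin.last m)]
        · simp [h]
        · intro b _ hb
          rw [if_neg]
          rintro ⟨h1, -⟩
          exact hb (Fin.ext (by simpa using h1))
        · simp
      rw [e]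
      exact h.add_one
  · have e : ∑ i, makeEven d i = ∑ i, d i := by simp only [makeEven, h, and_false, if_false, add_zero]
    rw [e]
    exact Nat.not_odd_iff_even.mp h

instance nonempty_pairing {n : ℕ} (d : Fin n → ℕ) : Nonempty (Pairing (makeEven d)) := by
  obtain ⟨m, hm⟩ := even_sum_makeEven d
  have hc : Fintype.card (Stub (makeEven d)) = Fintype.card (Fin m × Bool) := by
    simp [hm, mul_two]
  let e := Fintype.equivOfCardEq hc
  let t : Equiv.Perm (Fin m × Bool) := Equiv.prodCongr (Equiv.refl _) Equiv.boolNot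
  refine ⟨(e.trans t).trans e.symm, fun s => ⟨?_, fun h => ?_⟩⟩
  · have ht : ∀ x, t (t x) = x := by rintro ⟨a, b⟩; simp [t]
    simp only [Equiv.trans_apply, Equiv.apply_symm_apply, ht, Equiv.symm_apply_apply]
  · have h' : t (e s) = e s := by simpa using congrArg e h
    have h2 := congrArg Prod.snd h'
    simp [t] at h2

/-- The law of the random multigraph on `n` nodes generated by the configuration model: draw `n`
independent degrees from `f`, correct the last one by one if their sum is odd, and pair the stubs
uniformly at random. -/
def configurationModel (f : PMF ℕ) (n : ℕ) : PMF (Multigraph n) :=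
  (iidLaw f n).bind fun d => (PMF.uniformOfFintype (Pairing (makeEven d))).map Pairing.graph

end

/-! For symmetric `G` and `k ≥ 1` the ANNR is `rankSum k / stubsAt k`. Numerator, denominator, total
degree and size-biased CDF are all driven by per-node or per-edge terms that change only at nodes
losing an edge. Hence erasure moves the ANNR by at most `5 * erasedMass / stubsAt k`
(`abs_annr_erase_sub_le`). As `stubsAt k` is of order `n` when `f k > 0`, it remains to see that
`erasedMass` is `o(n)` in probability.

Nodes of degree above a constant `M` carry at most a small multiple of `n`, since `f` has finite
mean. A node `i` of degree at most `M` loses an edge only if two of its stubs are matched together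
or lead to the same node. With `L` stubs and maximal degree `m` this has probability at most `6 * d
i ^ 2 * m / L`, so the expected mass of these nodes is at most `6 * M ^ 2 * m`
(`Pairing.sum_erasedMass_truncated_le`). Finite mean also gives `m = o(n)`, because `m` is at most a
constant `K` plus the mass of degrees above `K`. Chebyshev (`tendsto_measure_countEq_le`) and Markov
(`exists_measure_tailSum_le`) show that typical degree sequences have these properties. -/

/-! ### Deterministic effect of erasure on the ANNR -/

namespace Multigraph

variable {n : ℕ} (G : Multigraph n)

theorem erase_le (i j : Fin n) : G.erase i j ≤ G i j := by
  unfold erase; split_ifs <;> omega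

theorem degree_erase_le (i : Fin n) : G.erase.degree i ≤ G.degree i :=
  Finset.sum_le_sum fun j _ => G.erase_le i j

theorem erase_symm (hG : ∀ i j, G i j = G j i) (i j : Fin n) : G.erase i j = G.erase j i := by
  simp only [erase, hG i j, eq_comm]

theorem erase_eq_of_degree_eq {i : Fin n} (h : G.erase.degree i = G.degree i) (j : Fin n) :
    G.erase i j = G i j :=
  (Finset.sum_eq_sum_iff_of_le fun j _ => G.erase_le i j).1 h j (Finset.mem_univ j)

theorem degree_le_totalDegree (i : Fin n) : G.degree i ≤ G.totalDegree :=
  Finset.single_le_sum (f := G.degree) (fun _ _ => Nat.zero_le _) (Finset.mem_univ i)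

theorem cast_degree (i : Fin n) : (G.degree i : ℝ) = ∑ j, (G i j : ℝ) := by
  simp [degree]

theorem cast_totalDegree : (G.totalDegree : ℝ) = ∑ i, (G.degree i : ℝ) := by
  simp [totalDegree]

/-- The number of edge ends at the nodes of degree `k`. -/
noncomputable def stubsAt (k : ℕ) : ℝ := ∑ i, if G.degree i = k then (G.degree i : ℝ) else 0

/-- The sum of the ranks of the neighbors of all nodes of degree `k`. -/
noncomputable def rankSum (k : ℕ) : ℝ :=
  ∑ i, ∑ j, if G.degree i = k then (G i j : ℝ) * G.sizeBiasedCDF (G.degree j) else 0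

theorem sizeBiasedCDF_nonneg (l : ℕ) : 0 ≤ G.sizeBiasedCDF l := by
  unfold sizeBiasedCDF; positivity

theorem sizeBiasedCDF_le_one (l : ℕ) : G.sizeBiasedCDF l ≤ 1 := by
  unfold sizeBiasedCDF
  refine div_le_one_of_le₀ ?_ (by positivity)
  rw [cast_totalDegree]
  refine Finset.sum_le_sum fun i _ => ?_
  split_ifs <;> simp

theorem stubsAt_nonneg (k : ℕ) : 0 ≤ G.stubsAt k := by
  unfold stubsAt; positivity

theorem stubsAt_le (k : ℕ) : G.stubsAt k ≤ G.totalDegree := by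
  rw [cast_totalDegree, stubsAt]
  refine Finset.sum_le_sum fun i _ => ?_
  split_ifs <;> simp

theorem rankSum_nonneg (k : ℕ) : 0 ≤ G.rankSum k := by
  unfold rankSum
  refine Finset.sum_nonneg fun i _ => Finset.sum_nonneg fun j _ => ?_
  have := G.sizeBiasedCDF_nonneg (G.degree j)
  positivity

theorem stubsAt_eq_sum (k : ℕ) :
    G.stubsAt k = ∑ i, ∑ j, if G.degree i = k then (G i j : ℝ) else 0 := by
  unfold stubsAt
  refine Finset.sum_congr rfl fun i _ => ?_
  split_ifs
  · exact G.cast_degree i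
  · simp

theorem rankSum_le (k : ℕ) : G.rankSum k ≤ G.stubsAt k := by
  rw [stubsAt_eq_sum, rankSum]
  refine Finset.sum_le_sum fun i _ => Finset.sum_le_sum fun j _ => ?_
  split_ifs
  · exact mul_le_of_le_one_right (by positivity) (G.sizeBiasedCDF_le_one _)
  · rfl

theorem sizeBiasedDensity_eq (k : ℕ) : G.sizeBiasedDensity k = G.stubsAt k / G.totalDegree := by
  rw [stubsAt_eq_sum, sizeBiasedDensity]
  simp

theorem sum_jointDensity_mul (hG : ∀ i j, G i j = G j i) (k : ℕ) :
    ∑ l ∈ Finset.Icc 1 G.totalDegree, G.jointDensity k l * G.sizeBiasedCDF l =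
      G.rankSum k / G.totalDegree := by
  simp only [jointDensity, div_mul_eq_mul_div, ← Finset.sum_div, Finset.sum_mul]
  congr 1
  rw [Finset.sum_comm, rankSum]
  refine Finset.sum_congr rfl fun i _ => ?_
  rw [Finset.sum_comm]
  refine Finset.sum_congr rfl fun j _ => ?_
  by_cases hi : G.degree i = k
  · simp only [hi, true_and, if_true]
    -- The sum over `l` starts at 1, which loses nothing: by symmetry a node of degree 0 is nobody's
    -- neighbor.
    by_cases hj : G.degree j = 0
    · have h0 : G i j = 0 := by
        have : G j i ≤ G.degree j :=
          Finset.single_le_sum (f := fun i => G j i) (fun _ _ => Nat.zero_le _) (Finset.mem_univ i)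
        rw [hG]; omega
      simp [h0]
    · rw [Finset.sum_eq_single (G.degree j)]
      · simp
      · intro l _ hl
        simp [hl.symm]
      · intro h
        exact absurd (Finset.mem_Icc.2 ⟨Nat.one_le_iff_ne_zero.2 hj, G.degree_le_totalDegree j⟩) h
  · simp [hi]

theorem annr_eq (hG : ∀ i j, G i j = G j i) {k : ℕ} (hk : 1 ≤ k) :
    G.annr k = G.rankSum k / G.stubsAt k := by
  rw [annr, sum_jointDensity_mul G hG, sizeBiasedDensity_eq]
  by_cases h : ∃ i, G.degree i = k
  · obtain ⟨i, hi⟩ := h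
    have hL : (G.totalDegree : ℝ) ≠ 0 := by
      have := G.degree_le_totalDegree i
      exact_mod_cast (by omega : G.totalDegree ≠ 0)
    have hn : 0 < n := i.pos
    have hpos : 0 < G.degreeDensity k := by
      unfold degreeDensity
      refine div_pos (Finset.sum_pos' (fun _ _ => by positivity) ⟨i, Finset.mem_univ i, ?_⟩)
        (by exact_mod_cast hn)
      simp [hi]
    rw [if_pos hpos, one_mul, div_div_div_cancel_right₀ hL]
  -- Without nodes of degree `k`, both sides are quotients by zero and hence 0.
  · push Not at h
    have h0 : G.stubsAt k = 0 := by simp [stubsAt, h]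
    simp [h0]

/-- The sum of the degrees of the nodes that lose an edge when `G` is erased. -/
noncomputable def erasedMass : ℝ := ∑ i, if G.erase.degree i = G.degree i then 0 else (G.degree i : ℝ)

theorem erasedMass_nonneg : 0 ≤ G.erasedMass := by
  unfold erasedMass; positivity

/-- Common source of the per-node comparisons: a node that keeps its degree contributes nothing to
the difference, any other at most its original degree. -/
theorem abs_sum_sub_le_erasedMass {x y : Fin n → ℝ}
    (heq : ∀ i, G.erase.degree i = G.degree i → x i = y i)
    (hx : ∀ i, 0 ≤ x i ∧ x i ≤ G.degree i) (hy : ∀ i, 0 ≤ y i ∧ y i ≤ G.degree i) :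
    |∑ i, x i - ∑ i, y i| ≤ G.erasedMass := by
  rw [← Finset.sum_sub_distrib]
  refine (Finset.abs_sum_le_sum_abs _ _).trans (Finset.sum_le_sum fun i _ => ?_)
  split_ifs with h
  · simp [heq i h]
  · rw [abs_le]
    constructor <;> linarith [hx i, hy i]

theorem abs_div_sub_div_le {a a' b b' e f : ℝ} (hb : 0 < b) (hb' : 0 ≤ b')
    (ha' : 0 ≤ a') (hab : 0 ≤ a) (hab1 : a ≤ b) (hab' : a' ≤ b') (h1 : |a' - a| ≤ e) (h2 : |b' - b| ≤ f)
    : |a' / b' - a / b| ≤ (e + f) / b := by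
  -- If `b' = 0`, then `a' = 0` and the first quotient is 0 by convention; the bound survives
  -- because `f ≥ b ≥ a`.
  rcases hb'.eq_or_lt with h0 | h0
  · have hA : a' = 0 := by linarith
    subst hA
    rw [← h0] at h2 ⊢
    have : b ≤ f := by simpa [abs_of_pos hb] using h2
    have he : 0 ≤ e := (abs_nonneg _).trans h1
    rw [div_zero, zero_sub, abs_neg, abs_of_nonneg (by positivity)]
    gcongr
    linarith
  · have hkey : a' / b' - a / b = ((a' - a) - a' / b' * (b' - b)) / b := by
      field_simp
      ring
    rw [hkey, abs_div, abs_of_pos hb]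
    gcongr
    refine (abs_sub _ _).trans (add_le_add h1 ?_)
    rw [abs_mul, abs_of_nonneg (by positivity)]
    exact (mul_le_of_le_one_left (abs_nonneg _) (div_le_one_of_le₀ hab' hb')).trans h2

theorem cast_degree_erase_le (i : Fin n) : (G.erase.degree i : ℝ) ≤ G.degree i := by
  exact_mod_cast G.degree_erase_le i

theorem abs_stubsAt_erase_sub_le (k : ℕ) :
    |G.erase.stubsAt k - G.stubsAt k| ≤ G.erasedMass := by
  refine G.abs_sum_sub_le_erasedMass (fun i h => by rw [h]) (fun i => ?_) (fun i => ?_)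
  · have := G.cast_degree_erase_le i
    split_ifs <;> constructor <;> linarith [(G.erase.degree i).cast_nonneg (α := ℝ)]
  · split_ifs <;> simp

theorem abs_totalDegree_erase_sub_le :
    |(G.erase.totalDegree : ℝ) - G.totalDegree| ≤ G.erasedMass := by
  rw [cast_totalDegree, cast_totalDegree]
  exact G.abs_sum_sub_le_erasedMass (fun i h => by rw [h])
    (fun i => ⟨by positivity, G.cast_degree_erase_le i⟩) (fun i => ⟨by positivity, le_rfl⟩)

theorem abs_sizeBiasedCDF_erase_sub_le (hL : 0 < G.totalDegree) (l : ℕ) :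
    |G.erase.sizeBiasedCDF l - G.sizeBiasedCDF l| ≤ 2 * G.erasedMass / G.totalDegree := by
  rw [two_mul]
  have key : ∀ H : Multigraph n, 0 ≤ ∑ i, (H.degree i : ℝ) * (if H.degree i ≤ l then 1 else 0) ∧
      ∑ i, (H.degree i : ℝ) * (if H.degree i ≤ l then 1 else 0) ≤ H.totalDegree := by
    intro H
    refine ⟨by positivity, ?_⟩
    rw [cast_totalDegree]
    refine Finset.sum_le_sum fun i _ => ?_
    split_ifs <;> simp
  refine abs_div_sub_div_le (by exact_mod_cast hL) (by positivity) (key _).1 (key _).1 (key _).2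
    (key _).2 ?_ G.abs_totalDegree_erase_sub_le
  refine G.abs_sum_sub_le_erasedMass (fun i h => by rw [h]) (fun i => ?_) (fun i => ?_)
  · have := G.cast_degree_erase_le i
    split_ifs <;> simp [this]
  · split_ifs <;> simp

/-- The 4 is 1 + 1 + 2: edge ends whose first node loses an edge, those whose second node does, and
the shift `e` of the CDF over at most `totalDegree` remaining ends. -/
theorem abs_rankSum_erase_sub_le (hG : ∀ i j, G i j = G j i) (hL : 0 < G.totalDegree) (k : ℕ) :
    |G.erase.rankSum k - G.rankSum k| ≤ 4 * G.erasedMass := by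
  have hL' : (0 : ℝ) < G.totalDegree := by exact_mod_cast hL
  set e := 2 * G.erasedMass / G.totalDegree with he
  have he0 : 0 ≤ e := by have := G.erasedMass_nonneg; positivity
  have hterm : ∀ i j,
      |(if G.erase.degree i = k then (G.erase i j : ℝ) * G.erase.sizeBiasedCDF (G.erase.degree j)
          else 0) - (if G.degree i = k then (G i j : ℝ) * G.sizeBiasedCDF (G.degree j) else 0)| ≤
        ((if G.erase.degree i = G.degree i then 0 else (G i j : ℝ)) +
          -- Written with `G j i` so that exchanging the two sums turns this term into `erasedMass`
          -- again.
          (if G.erase.degree j = G.degree j then 0 else (G j i : ℝ))) +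
          (if G.degree i = k then (G i j : ℝ) else 0) * e := by
    intro i j
    have hg : (G.erase i j : ℝ) ≤ G i j := by exact_mod_cast G.erase_le i j
    have hg0 : (0 : ℝ) ≤ G.erase i j := by positivity
    have b1 : ∀ p : Prop, [Decidable p] →
        0 ≤ (if p then (G.erase i j : ℝ) * G.erase.sizeBiasedCDF (G.erase.degree j) else 0) ∧
        (if p then (G.erase i j : ℝ) * G.erase.sizeBiasedCDF (G.erase.degree j) else 0) ≤
          G i j := by
      intro p _
      have h0 := G.erase.sizeBiasedCDF_nonneg (G.erase.degree j)
      have h1 := mul_le_of_le_one_right hg0 (G.erase.sizeBiasedCDF_le_one (G.erase.degree j))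
      split_ifs
      · exact ⟨by positivity, h1.trans hg⟩
      · exact ⟨le_rfl, by positivity⟩
    have b2 : 0 ≤ (if G.degree i = k then (G i j : ℝ) * G.sizeBiasedCDF (G.degree j) else 0) ∧
        (if G.degree i = k then (G i j : ℝ) * G.sizeBiasedCDF (G.degree j) else 0) ≤ G i j := by
      have h0 := G.sizeBiasedCDF_nonneg (G.degree j)
      have h1 := mul_le_of_le_one_right (hg0.trans hg) (G.sizeBiasedCDF_le_one (G.degree j))
      split_ifs
      · exact ⟨by positivity, h1⟩
      · exact ⟨le_rfl, by positivity⟩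
    have hlast : 0 ≤ (if G.degree i = k then (G i j : ℝ) else 0) * e := by positivity
    have hGij : (0 : ℝ) ≤ G i j := by positivity
    have hrough := abs_sub_le_of_nonneg_of_le (b1 (G.erase.degree i = k)).1
      (b1 (G.erase.degree i = k)).2 b2.1 b2.2
    by_cases hi : G.erase.degree i = G.degree i
    · by_cases hj : G.erase.degree j = G.degree j
      -- Both ends keep their degrees, so the edge itself is intact and only the CDF differs.
      · rw [hi, hj, G.erase_eq_of_degree_eq hi j]
        simp only [if_true, add_zero, zero_add]
        split_ifs
        · rw [← mul_sub, abs_mul, abs_of_nonneg hGij]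
          exact mul_le_mul_of_nonneg_left (G.abs_sizeBiasedCDF_erase_sub_le hL _) hGij
        · simp
      · rw [if_pos hi, if_neg hj, ← hG i j]
        linarith
    · rw [if_neg hi]
      have : (0 : ℝ) ≤ (if G.erase.degree j = G.degree j then 0 else (G j i : ℝ)) := by positivity
      linarith
  unfold rankSum
  simp only [← Finset.sum_sub_distrib]
  refine (Finset.abs_sum_le_sum_abs _ _).trans ((Finset.sum_le_sum fun i _ =>
    (Finset.abs_sum_le_sum_abs _ _).trans (Finset.sum_le_sum fun j _ => hterm i j)).trans ?_)
  simp only [Finset.sum_add_distrib, ← Finset.sum_mul]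
  rw [← stubsAt_eq_sum]
  have hm : ∑ i, ∑ j, (if G.erase.degree i = G.degree i then 0 else (G i j : ℝ)) =
      G.erasedMass := by
    unfold erasedMass
    refine Finset.sum_congr rfl fun i _ => ?_
    split_ifs
    · simp
    · rw [cast_degree]
  rw [hm, Finset.sum_comm, hm]
  have : G.stubsAt k * e ≤ 2 * G.erasedMass := by
    calc G.stubsAt k * e ≤ G.totalDegree * e := by gcongr; exact G.stubsAt_le k
      _ = 2 * G.erasedMass := by rw [he]; field_simp
  linarith

/-- Erasing changes the average nearest neighbor rank at `k` by a multiple of the mass of the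
nodes whose degree changes. -/
theorem abs_annr_erase_sub_le (hG : ∀ i j, G i j = G j i) {k : ℕ} (hk : 1 ≤ k)
    (hpos : 0 < G.stubsAt k) :
    |G.erase.annr k - G.annr k| ≤ 5 * G.erasedMass / G.stubsAt k := by
  have hL : 0 < G.totalDegree := by exact_mod_cast hpos.trans_le (G.stubsAt_le k)
  rw [annr_eq _ (G.erase_symm hG) hk, annr_eq _ hG hk]
  refine (abs_div_sub_div_le hpos (stubsAt_nonneg _ k) (rankSum_nonneg _ k) (rankSum_nonneg _ k)
    (rankSum_le _ k) (rankSum_le _ k) (G.abs_rankSum_erase_sub_le hG hL k)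
    (G.abs_stubsAt_erase_sub_le k)).trans_eq ?_
  congr 1
  ring

end Multigraph

/-! ### Counting pairings by relabeling stubs -/

namespace Pairing

variable {n : ℕ} {d : Fin n → ℕ}

/-- Relabel the stubs of a pairing. -/
def conj (e : Equiv.Perm (Stub d)) : Equiv.Perm (Pairing d) where
  toFun σ := ⟨(e.symm.trans σ.1).trans e, fun s => by
    have h := σ.2 (e.symm s)
    exact ⟨by simp [h.1], fun h' => h.2 ((Equiv.eq_symm_apply e).2 h')⟩⟩
  invFun σ := ⟨(e.trans σ.1).trans e.symm, fun s => by
    have h := σ.2 (e s)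
    exact ⟨by simp [h.1], fun h' => h.2 ((Equiv.symm_apply_eq e).1 h')⟩⟩
  left_inv σ := by ext1; ext1 s; simp
  right_inv σ := by ext1; ext1 s; simp

theorem conj_apply (e : Equiv.Perm (Stub d)) (σ : Pairing d) (s : Stub d) :
    (conj e σ).1 s = e (σ.1 (e.symm s)) := rfl

/-- Exchangeability in place of an explicit count of pairings: swapping the labels `u` and `v`
injects the event that `t` is matched to `u` into the event that it is matched to `v`, preserving
`p`. Over `v ∈ U` these events are disjoint. -/
theorem card_filter_mul_card_le (p : Pairing d → Prop) [DecidablePred p] (t : Stub d)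
    (U : Finset (Stub d)) (htU : t ∉ U)
    (hp : ∀ u ∈ U, ∀ v ∈ U, ∀ σ, p σ → p (conj (Equiv.swap u v) σ)) {u : Stub d} (hu : u ∈ U) :
    (Finset.univ.filter fun σ : Pairing d => p σ ∧ σ.1 t = u).card * U.card ≤
      (Finset.univ.filter p).card := by
  have hle : ∀ v ∈ U, (Finset.univ.filter fun σ : Pairing d => p σ ∧ σ.1 t = u).card ≤
      (Finset.univ.filter fun σ : Pairing d => p σ ∧ σ.1 t = v).card := by
    intro v hv
    refine Finset.card_le_card_of_injOn (conj (Equiv.swap u v)) ?_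
      (conj (Equiv.swap u v)).injective.injOn
    intro σ hσ
    simp only [Finset.coe_filter, Finset.mem_univ, true_and, Set.mem_ofPred_eq] at hσ ⊢
    refine ⟨hp u hu v hv σ hσ.1, ?_⟩
    rw [conj_apply, Equiv.symm_swap, Equiv.swap_apply_of_ne_of_ne (x := t)
      (ne_of_mem_of_not_mem hu htU).symm (ne_of_mem_of_not_mem hv htU).symm, hσ.2,
      Equiv.swap_apply_left]
  calc _ = ∑ _v ∈ U, (Finset.univ.filter fun σ : Pairing d => p σ ∧ σ.1 t = u).card := by
        rw [Finset.sum_const, smul_eq_mul, mul_comm]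
    _ ≤ ∑ v ∈ U, (Finset.univ.filter fun σ : Pairing d => p σ ∧ σ.1 t = v).card :=
        Finset.sum_le_sum hle
    _ = (U.biUnion fun v => Finset.univ.filter fun σ : Pairing d => p σ ∧ σ.1 t = v).card := by
        rw [Finset.card_biUnion]
        intro v _ w _ hvw
        rw [Function.onFun, Finset.disjoint_left]
        intro σ h1 h2
        simp only [Finset.mem_filter, Finset.mem_univ, true_and] at h1 h2
        exact hvw (h1.2.symm.trans h2.2)
    _ ≤ _ := by
        refine Finset.card_le_card fun σ hσ => ?_
        simp only [Finset.mem_biUnion, Finset.mem_filter, Finset.mem_univ, true_and] at hσ ⊢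
        exact hσ.choose_spec.2.1

theorem card_apply_eq_mul_le (s t : Stub d) :
    (Finset.univ.filter fun σ : Pairing d => σ.1 s = t).card * (Fintype.card (Stub d) - 1) ≤
      Fintype.card (Pairing d) := by
  by_cases hst : t = s
  · rw [Finset.card_eq_zero.2, zero_mul]
    · exact Nat.zero_le _
    · rw [Finset.filter_eq_empty_iff]
      intro σ _
      rw [hst]
      exact (σ.2 s).2
  · have h := card_filter_mul_card_le (fun _ : Pairing d => True) s (Finset.univ.erase s)
      (Finset.notMem_erase _ _) (fun _ _ _ _ _ _ => trivial) (u := t) (by simp [hst])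
    simpa [Finset.card_erase_of_mem, Finset.card_univ] using h

theorem card_apply_eq_and_mul_le {s t a b : Stub d} (hst : s ≠ t) (hab : a ≠ b) (hat : a ≠ t)
    (hbs : b ≠ s) :
    (Finset.univ.filter fun σ : Pairing d => σ.1 s = a ∧ σ.1 t = b).card *
      ((Fintype.card (Stub d) - 1) * (Fintype.card (Stub d) - 3)) ≤ Fintype.card (Pairing d) := by
  by_cases hbt : b = t
  · rw [Finset.card_eq_zero.2, zero_mul]
    · exact Nat.zero_le _
    · rw [Finset.filter_eq_empty_iff]
      rintro σ _ ⟨-, h⟩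
      rw [hbt] at h
      exact (σ.2 t).2 h
  by_cases has : a = s
  · rw [Finset.card_eq_zero.2, zero_mul]
    · exact Nat.zero_le _
    · rw [Finset.filter_eq_empty_iff]
      rintro σ _ ⟨h, -⟩
      rw [has] at h
      exact (σ.2 s).2 h
  have h := card_filter_mul_card_le (fun σ : Pairing d => σ.1 s = a) t
    (Finset.univ \ {s, t, a}) (by simp) (fun u hu v hv σ hσ => by
      simp only [Finset.mem_sdiff, Finset.mem_univ, true_and, Finset.mem_insert,
        Finset.mem_singleton, not_or] at hu hv
      rw [conj_apply, Equiv.symm_swap,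
        Equiv.swap_apply_of_ne_of_ne (Ne.symm hu.1) (Ne.symm hv.1), hσ,
        Equiv.swap_apply_of_ne_of_ne (Ne.symm hu.2.2) (Ne.symm hv.2.2)])
    (u := b) (by simp [hbs, hbt, hab.symm])
  rw [Finset.card_sdiff_of_subset (Finset.subset_univ _), Finset.card_univ,
    Finset.card_eq_three.2 ⟨s, t, a, hst, Ne.symm has, hat.symm, rfl⟩] at h
  calc _ = (Finset.univ.filter fun σ : Pairing d => σ.1 s = a ∧ σ.1 t = b).card *
        (Fintype.card (Stub d) - 3) * (Fintype.card (Stub d) - 1) := by ring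
    _ ≤ _ := Nat.mul_le_mul_right _ h
    _ ≤ _ := card_apply_eq_mul_le s a

theorem graph_symm (σ : Pairing d) (i j : Fin n) : σ.graph i j = σ.graph j i := by
  refine Fintype.card_congr ⟨fun s => ⟨σ.1 s.1, s.2.2, ?_⟩, fun s => ⟨σ.1 s.1, s.2.2, ?_⟩,
    fun s => ?_, fun s => ?_⟩
  · rw [(σ.2 _).1]; exact s.2.1
  · rw [(σ.2 _).1]; exact s.2.1
  · exact Subtype.ext (σ.2 _).1
  · exact Subtype.ext (σ.2 _).1

theorem degree_graph (σ : Pairing d) (i : Fin n) : σ.graph.degree i = d i := by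
  unfold Multigraph.degree Pairing.graph
  simp only [Fintype.card_subtype]
  have h := Finset.card_eq_sum_card_fiberwise (f := fun s : Stub d => (σ.1 s).1)
    (s := Finset.univ.filter fun s : Stub d => s.1 = i) (t := Finset.univ)
    (fun _ _ => Finset.mem_coe.2 (Finset.mem_univ _))
  simp only [Finset.filter_filter] at h
  rw [← h, ← Fintype.card_subtype,
    Fintype.card_congr (Equiv.sigmaSubtype (β := fun i => Fin (d i)) i), Fintype.card_fin]

/-- If no two stubs at `i` are matched together or lead to a common other node, row `i` has zero
diagonal and entries at most 1, so erasure leaves it unchanged. -/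
theorem exists_of_degree_erase_ne (σ : Pairing d) {i : Fin n}
    (h : σ.graph.erase.degree i ≠ σ.graph.degree i) :
    ∃ s t : Fin (d i), σ.1 ⟨i, s⟩ = ⟨i, t⟩ ∨
      (s ≠ t ∧ (σ.1 ⟨i, s⟩).1 = (σ.1 ⟨i, t⟩).1 ∧ (σ.1 ⟨i, s⟩).1 ≠ i) := by
  contrapose! h
  refine Finset.sum_congr rfl fun j _ => ?_
  unfold Multigraph.erase
  split_ifs with hij
  · subst hij
    symm
    refine Fintype.card_eq_zero_iff.2 ⟨?_⟩
    rintro ⟨⟨i', s⟩, rfl, hs⟩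
    dsimp only at hs
    rcases hx : σ.1 ⟨i', s⟩ with ⟨j, t⟩
    rw [hx] at hs
    obtain rfl : j = i' := hs
    exact (h s t).1 hx
  · refine min_eq_left (Fintype.card_le_one_iff.2 ?_)
    rintro ⟨⟨i', s⟩, rfl, hs⟩ ⟨⟨i'', t⟩, h2, ht⟩
    dsimp only at hs ht h2 ⊢
    subst h2
    by_contra hne
    refine hij ((h s t).2 ?_ (hs.trans ht.symm) ▸ hs)
    rintro rfl
    exact hne rfl

/-- Union bound over the partner `a` of the first stub and the at most `m` stubs `y` at the same
node as `a`. -/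
theorem card_same_neighbor_mul_le {m : ℕ} (hm : ∀ j, d j ≤ m) {i : Fin n} {s t : Fin (d i)}
    (hst : s ≠ t) :
    (Finset.univ.filter fun σ : Pairing d =>
        (σ.1 ⟨i, s⟩).1 = (σ.1 ⟨i, t⟩).1 ∧ (σ.1 ⟨i, s⟩).1 ≠ i).card *
      ((Fintype.card (Stub d) - 1) * (Fintype.card (Stub d) - 3)) ≤
      Fintype.card (Stub d) * m * Fintype.card (Pairing d) := by
  have hsub : (Finset.univ.filter fun σ : Pairing d =>
        (σ.1 ⟨i, s⟩).1 = (σ.1 ⟨i, t⟩).1 ∧ (σ.1 ⟨i, s⟩).1 ≠ i) ⊆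
      Finset.univ.biUnion fun a : Stub d => Finset.univ.biUnion fun y : Fin (d a.1) =>
        Finset.univ.filter fun σ : Pairing d =>
          (a ≠ ⟨a.1, y⟩ ∧ a.1 ≠ i) ∧ σ.1 ⟨i, s⟩ = a ∧ σ.1 ⟨i, t⟩ = ⟨a.1, y⟩ := by
    intro σ hσ
    simp only [Finset.mem_filter, Finset.mem_univ, true_and, Finset.mem_biUnion] at hσ ⊢
    obtain ⟨y, hy⟩ : ∃ y, σ.1 ⟨i, t⟩ = ⟨(σ.1 ⟨i, s⟩).1, y⟩ := by
      rcases hx : σ.1 ⟨i, t⟩ with ⟨j, y⟩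
      rw [hx] at hσ
      obtain ⟨h1, -⟩ := hσ
      dsimp only at h1
      rw [h1]
      exact ⟨y, rfl⟩
    refine ⟨_, y, ⟨?_, hσ.2⟩, rfl, hy⟩
    rw [← hy]
    intro h
    have := σ.1.injective h
    simp only [Sigma.mk.injEq, heq_eq_eq, true_and] at this
    exact hst this
  have hc : ∀ (a : Stub d) (y : Fin (d a.1)),
      (Finset.univ.filter fun σ : Pairing d =>
          (a ≠ ⟨a.1, y⟩ ∧ a.1 ≠ i) ∧ σ.1 ⟨i, s⟩ = a ∧ σ.1 ⟨i, t⟩ = ⟨a.1, y⟩).card *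
        ((Fintype.card (Stub d) - 1) * (Fintype.card (Stub d) - 3)) ≤
        Fintype.card (Pairing d) := by
    intro a y
    by_cases h : a ≠ ⟨a.1, y⟩ ∧ a.1 ≠ i
    · simp only [h, not_false_eq_true, ne_eq, true_and]
      refine card_apply_eq_and_mul_le (by simpa using hst) h.1 ?_ ?_
      · rintro rfl; exact h.2 rfl
      · intro h'; exact h.2 (congrArg Sigma.fst h')
    · simp only [h, false_and, Finset.filter_false, Finset.card_empty, zero_mul, zero_le]
  calc _ ≤ (∑ a : Stub d, ∑ y : Fin (d a.1), (Finset.univ.filter fun σ : Pairing d =>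
          (a ≠ ⟨a.1, y⟩ ∧ a.1 ≠ i) ∧ σ.1 ⟨i, s⟩ = a ∧ σ.1 ⟨i, t⟩ = ⟨a.1, y⟩).card) *
        ((Fintype.card (Stub d) - 1) * (Fintype.card (Stub d) - 3)) := by
        refine Nat.mul_le_mul_right _ ((Finset.card_le_card hsub).trans ?_)
        exact Finset.card_biUnion_le.trans (Finset.sum_le_sum fun a _ => Finset.card_biUnion_le)
    _ ≤ ∑ a : Stub d, ∑ _y : Fin (d a.1), Fintype.card (Pairing d) := by
        simp only [Finset.sum_mul]
        exact Finset.sum_le_sum fun a _ => Finset.sum_le_sum fun y _ => hc a y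
    _ ≤ ∑ _a : Stub d, m * Fintype.card (Pairing d) := by
        refine Finset.sum_le_sum fun a _ => ?_
        simp only [Finset.sum_const, Finset.card_univ, Fintype.card_fin, smul_eq_mul]
        exact Nat.mul_le_mul_right _ (hm _)
    _ = _ := by simp only [Finset.sum_const, Finset.card_univ, smul_eq_mul]; ring

/-- Union bound over the `d i ^ 2` pairs of stubs at `i`. The 6 is 2 for self-loops plus 4 for
multiple edges, from `Λ ≤ 2 * (Λ - 1)` and `Λ ^ 2 ≤ 4 * (Λ - 1) * (Λ - 3)` when `Λ ≥ 6`. -/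
theorem card_degree_erase_ne_le {m : ℕ} (hm : ∀ j, d j ≤ m) (hm1 : 1 ≤ m)
    (hL : 6 ≤ Fintype.card (Stub d)) (i : Fin n) :
    ((Finset.univ.filter fun σ : Pairing d =>
        σ.graph.erase.degree i ≠ σ.graph.degree i).card : ℝ) ≤
      (d i : ℝ) ^ 2 * (6 * m / Fintype.card (Stub d) * Fintype.card (Pairing d)) := by
  have hL' : (6 : ℝ) ≤ Fintype.card (Stub d) := by exact_mod_cast hL
  have hm' : (1 : ℝ) ≤ m := by exact_mod_cast hm1
  have c1 : ((Fintype.card (Stub d) - 1 : ℕ) : ℝ) = (Fintype.card (Stub d) : ℝ) - 1 := by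
    rw [Nat.cast_sub (by omega)]; simp
  have c3 : ((Fintype.card (Stub d) - 3 : ℕ) : ℝ) = (Fintype.card (Stub d) : ℝ) - 3 := by
    rw [Nat.cast_sub (by omega)]; simp
  set Λ : ℝ := ((Fintype.card (Stub d) : ℕ) : ℝ) with hΛ
  set N : ℝ := ((Fintype.card (Pairing d) : ℕ) : ℝ) with hN
  have hN0 : 0 ≤ N := by positivity
  have hpair : ∀ s t : Fin (d i), ((Finset.univ.filter fun σ : Pairing d =>
      σ.1 ⟨i, s⟩ = ⟨i, t⟩ ∨ (s ≠ t ∧ (σ.1 ⟨i, s⟩).1 = (σ.1 ⟨i, t⟩).1 ∧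
        (σ.1 ⟨i, s⟩).1 ≠ i)).card : ℝ) ≤ 6 * m / Λ * N := by
    intro s t
    have h1 : ((Finset.univ.filter fun σ : Pairing d => σ.1 ⟨i, s⟩ = ⟨i, t⟩).card : ℝ) ≤
        2 * m / Λ * N := by
      have h : ((Finset.univ.filter fun σ : Pairing d => σ.1 ⟨i, s⟩ = ⟨i, t⟩).card : ℝ) *
          (Λ - 1) ≤ N := by
        rw [← c1, hN]
        exact_mod_cast card_apply_eq_mul_le (d := d) ⟨i, s⟩ ⟨i, t⟩
      rw [← le_div_iff₀ (by linarith)] at h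
      refine h.trans ?_
      rw [div_mul_eq_mul_div, div_le_div_iff₀ (by linarith) (by linarith)]
      have : Λ ≤ 2 * m * (Λ - 1) := by nlinarith
      nlinarith
    have h2 : ((Finset.univ.filter fun σ : Pairing d => s ≠ t ∧
        (σ.1 ⟨i, s⟩).1 = (σ.1 ⟨i, t⟩).1 ∧ (σ.1 ⟨i, s⟩).1 ≠ i).card : ℝ) ≤
        4 * m / Λ * N := by
      by_cases hst : s = t
      · simp only [hst, ne_eq, not_true_eq_false, false_and, Finset.filter_false,
          Finset.card_empty, Nat.cast_zero]
        positivity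
      · simp only [ne_eq, hst, not_false_eq_true, true_and]
        have h : ((Finset.univ.filter fun σ : Pairing d =>
            (σ.1 ⟨i, s⟩).1 = (σ.1 ⟨i, t⟩).1 ∧ (σ.1 ⟨i, s⟩).1 ≠ i).card : ℝ) *
            ((Λ - 1) * (Λ - 3)) ≤ Λ * m * N := by
          rw [← c1, ← c3, hN, hΛ]
          exact_mod_cast card_same_neighbor_mul_le hm hst
        rw [← le_div_iff₀ (by nlinarith)] at h
        refine h.trans ?_
        rw [div_mul_eq_mul_div, div_le_div_iff₀ (by nlinarith) (by linarith)]
        have : Λ * Λ ≤ 4 * ((Λ - 1) * (Λ - 3)) := by nlinarith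
        have hmN : 0 ≤ m * N := by positivity
        nlinarith [mul_le_mul_of_nonneg_left this hmN]
    rw [Finset.filter_or]
    calc _ ≤ ((Finset.univ.filter fun σ : Pairing d => σ.1 ⟨i, s⟩ = ⟨i, t⟩).card : ℝ) +
          ((Finset.univ.filter fun σ : Pairing d => s ≠ t ∧
            (σ.1 ⟨i, s⟩).1 = (σ.1 ⟨i, t⟩).1 ∧ (σ.1 ⟨i, s⟩).1 ≠ i).card : ℝ) := by
          exact_mod_cast Finset.card_union_le _ _
      _ ≤ _ := (add_le_add h1 h2).trans_eq (by ring)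
  have hsub : (Finset.univ.filter fun σ : Pairing d =>
        σ.graph.erase.degree i ≠ σ.graph.degree i) ⊆
      Finset.univ.biUnion fun s : Fin (d i) => Finset.univ.biUnion fun t : Fin (d i) =>
        Finset.univ.filter fun σ : Pairing d => σ.1 ⟨i, s⟩ = ⟨i, t⟩ ∨
          (s ≠ t ∧ (σ.1 ⟨i, s⟩).1 = (σ.1 ⟨i, t⟩).1 ∧ (σ.1 ⟨i, s⟩).1 ≠ i) := by
    intro σ hσ
    simp only [Finset.mem_biUnion, Finset.mem_filter, Finset.mem_univ, true_and] at hσ ⊢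
    exact exists_of_degree_erase_ne σ hσ
  have hcard := (Finset.card_le_card hsub).trans (Finset.card_biUnion_le.trans
    (Finset.sum_le_sum fun s _ => Finset.card_biUnion_le))
  calc _ ≤ ∑ s : Fin (d i), ∑ t : Fin (d i), ((Finset.univ.filter fun σ : Pairing d =>
      σ.1 ⟨i, s⟩ = ⟨i, t⟩ ∨ (s ≠ t ∧ (σ.1 ⟨i, s⟩).1 = (σ.1 ⟨i, t⟩).1 ∧
        (σ.1 ⟨i, s⟩).1 ≠ i)).card : ℝ) := by exact_mod_cast hcard
    _ ≤ ∑ _s : Fin (d i), ∑ _t : Fin (d i), 6 * m / Λ * N :=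
        Finset.sum_le_sum fun s _ => Finset.sum_le_sum fun t _ => hpair s t
    _ = _ := by
        simp only [Finset.sum_const, Finset.card_univ, Fintype.card_fin, nsmul_eq_mul]
        ring

/-- The total over all pairings of the mass of the nodes of degree at most `M` that lose an
edge. -/
theorem sum_erasedMass_truncated_le {m : ℕ} (hm : ∀ j, d j ≤ m) (hm1 : 1 ≤ m)
    (hL : 6 ≤ Fintype.card (Stub d)) (M : ℕ) :
    ∑ σ : Pairing d, ∑ i, (if d i ≤ M ∧ σ.graph.erase.degree i ≠ σ.graph.degree i then
      (d i : ℝ) else 0) ≤ 6 * M ^ 2 * m * Fintype.card (Pairing d) := by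
  have hL' : (6 : ℝ) ≤ Fintype.card (Stub d) := by exact_mod_cast hL
  have hsum : (Fintype.card (Stub d) : ℝ) = ∑ i, (d i : ℝ) := by simp
  rw [Finset.sum_comm]
  calc _ ≤ ∑ i, (d i : ℝ) *
        ((M : ℝ) ^ 2 * (6 * m / Fintype.card (Stub d) * Fintype.card (Pairing d))) := by
        refine Finset.sum_le_sum fun i _ => ?_
        by_cases hi : d i ≤ M
        · simp only [hi, true_and, ← Finset.sum_filter, Finset.sum_const, nsmul_eq_mul]
          rw [mul_comm]
          refine mul_le_mul_of_nonneg_left ((card_degree_erase_ne_le hm hm1 hL i).trans ?_)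
            (by positivity)
          gcongr
        · simp only [hi, false_and, if_false, Finset.sum_const_zero]
          positivity
    _ = _ := by
        rw [← Finset.sum_mul, ← hsum]
        field_simp

end Pairing

/-! ### Probability bounds for mixtures, uniform laws and i.i.d. degrees -/

theorem toOuterMeasure_bind_le {α β : Type*} (p : PMF α) (q : α → PMF β) (s : Set β) (A : Set α)
    {ε : ENNReal} (h : ∀ a ∈ A, (q a).toOuterMeasure s ≤ ε) :
    (p.bind q).toOuterMeasure s ≤ p.toOuterMeasure Aᶜ + ε := by
  classical
  rw [PMF.toOuterMeasure_bind_apply, PMF.toOuterMeasure_apply]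
  calc _ ≤ ∑' a, (Aᶜ.indicator p a + p a * ε) := by
        refine ENNReal.tsum_le_tsum fun a => ?_
        by_cases ha : a ∈ A
        · exact le_add_left (mul_le_mul_right (h a ha) _)
        · rw [Set.indicator_of_mem (by exact ha)]
          refine le_add_right (mul_le_of_le_one_right' ?_)
          exact ((q a).toOuterMeasure.mono (Set.subset_univ s)).trans_eq
            (((q a).toOuterMeasure_apply_eq_one_iff _).2 (Set.subset_univ _))
    _ = _ := by rw [ENNReal.tsum_add, ENNReal.tsum_mul_right, p.tsum_coe, one_mul]

/-- Markov's inequality for the uniform law. -/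
theorem toOuterMeasure_uniformOfFintype_le {α : Type*} [Fintype α] [Nonempty α] (X : α → ℝ)
    (hX : ∀ a, 0 ≤ X a) (s : Set α) {x b : ℝ} (hx : 0 < x) (hs : ∀ a ∈ s, x ≤ X a)
    (hb : ∑ a, X a ≤ b * Fintype.card α) :
    (PMF.uniformOfFintype α).toOuterMeasure s ≤ ENNReal.ofReal (b / x) := by
  classical
  rw [PMF.toOuterMeasure_uniformOfFintype_apply]
  have hc : (0 : ℝ) < Fintype.card α := by exact_mod_cast Fintype.card_pos
  have h1 : (Fintype.card s : ℝ) * x ≤ b * Fintype.card α := by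
    refine le_trans ?_ hb
    calc (Fintype.card s : ℝ) * x = ∑ a ∈ s.toFinset, x := by
          rw [Finset.sum_const, Set.toFinset_card, nsmul_eq_mul]
      _ ≤ ∑ a ∈ s.toFinset, X a := Finset.sum_le_sum fun a ha => hs a (Set.mem_toFinset.1 ha)
      _ ≤ ∑ a, X a :=
          Finset.sum_le_sum_of_subset_of_nonneg (Finset.subset_univ _) fun a _ _ => hX a
  rw [← ENNReal.ofReal_natCast, ← ENNReal.ofReal_natCast, ← ENNReal.ofReal_div_of_pos hc]
  refine ENNReal.ofReal_le_ofReal ?_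
  rwa [div_le_div_iff₀ hc hx]

/-- The number of entries of `d` that equal `k`. -/
noncomputable def countEq {n : ℕ} (k : ℕ) (d : Fin n → ℕ) : ℝ :=
  ∑ i, if d i = k then (1 : ℝ) else 0

/-- The sum of the entries of `d` that are at least `M`. -/
noncomputable def tailSum {n : ℕ} (M : ℕ) (d : Fin n → ℕ) : ℝ :=
  ∑ i, if M ≤ d i then (d i : ℝ) else 0

theorem tendsto_measure_countEq_le (f : PMF ℕ) (k : ℕ) {c : ℝ} (hc : c < (f k).toReal) :
    Tendsto (fun n => (Measure.pi fun _ : Fin n => f.toMeasure) {d | countEq k d ≤ c * n})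
      atTop (𝓝 0) := by
  set g : ℕ → ℝ := fun x => if x = k then 1 else 0 with hg
  set V := Var[g; f.toMeasure]
  have hmem : MemLp g 2 f.toMeasure := by
    refine MemLp.of_bound (Measurable.of_discrete).aestronglyMeasurable 1 (ae_of_all _ fun x => ?_)
    simp only [hg]
    split_ifs <;> simp
  have hint : ∫ x, g x ∂f.toMeasure = (f k).toReal := by
    have : g = ({k} : Set ℕ).indicator 1 := by
      ext x
      simp [hg, Set.indicator_apply]
    rw [this, integral_indicator_one (measurableSet_singleton k), Measure.real,
      PMF.toMeasure_apply_singleton _ _ (measurableSet_singleton k)]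
  have hlim : Tendsto (fun n : ℕ => ENNReal.ofReal (V / ((f k).toReal - c) ^ 2 / n)) atTop
      (𝓝 0) := by
    rw [← ENNReal.ofReal_zero]
    exact ENNReal.tendsto_ofReal (tendsto_const_div_atTop_nhds_zero_nat _)
  refine tendsto_of_tendsto_of_tendsto_of_le_of_le' tendsto_const_nhds hlim
    (Eventually.of_forall fun _ => zero_le) ?_
  filter_upwards [eventually_ge_atTop 1] with n hn
  have hn' : (0 : ℝ) < n := by exact_mod_cast hn
  set X : (Fin n → ℕ) → ℝ := ∑ i, fun d => g (d i) with hX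
  have hcount : ∀ d, countEq k d = X d := fun d => by simp [hX, countEq, hg]
  have hcomp : ∀ i : Fin n, MemLp (fun d : Fin n → ℕ => g (d i)) 2
      (Measure.pi fun _ : Fin n => f.toMeasure) := fun i =>
    hmem.comp_measurePreserving (measurePreserving_eval (fun _ : Fin n => f.toMeasure) i)
  have hmX : MemLp X 2 (Measure.pi fun _ : Fin n => f.toMeasure) :=
    memLp_finsetSum' _ fun i _ => hcomp i
  have hmean : ∫ d, X d ∂(Measure.pi fun _ : Fin n => f.toMeasure) = n * (f k).toReal := by
    simp only [hX, Finset.sum_apply]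
    rw [integral_finsetSum _ fun i _ => (hcomp i).integrable (by norm_num)]
    have : ∀ i : Fin n, ∫ d, g (d i) ∂(Measure.pi fun _ : Fin n => f.toMeasure) =
        (f k).toReal := fun i => by
      rw [integral_comp_eval (μ := fun _ : Fin n => f.toMeasure) (i := i)
        (Measurable.of_discrete (f := g)).aestronglyMeasurable, hint]
    simp [this]
  have hvar : Var[X; Measure.pi fun _ : Fin n => f.toMeasure] = n * V := by
    rw [hX, variance_sum_pi (X := fun _ => g) fun _ => hmem]
    simp [V]
  have hpos : 0 < ((f k).toReal - c) * n := mul_pos (sub_pos.2 hc) hn'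
  refine (measure_mono ?_).trans ((meas_ge_le_variance_div_sq hmX hpos).trans_eq ?_)
  · intro d hd
    change countEq k d ≤ c * n at hd
    change _ ≤ |X d - _|
    rw [hmean, ← hcount, abs_sub_comm]
    refine le_trans ?_ (le_abs_self _)
    linarith
  · rw [hvar]
    congr 1
    have := (sub_pos.2 hc).ne'
    field_simp

/-- The truncated mean tends to 0 by dominated convergence. Markov's inequality then gives a bound
free of `n`, since the expected tail sum and the threshold are both linear in `n`. -/
theorem exists_measure_tailSum_le (f : PMF ℕ) (hf : Summable fun k : ℕ => (k : ℝ) * (f k).toReal)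
    {ε : ℝ} (hε : 0 < ε) {η : ENNReal} (hη : η ≠ 0) :
    ∃ M : ℕ, 1 ≤ M ∧ ∀ n : ℕ, 1 ≤ n →
      (Measure.pi fun _ : Fin n => f.toMeasure) {d | ε * n < tailSum M d} ≤ η := by
  set h : ℕ → ℕ → ENNReal := fun M x => if M ≤ x then (x : ENNReal) else 0 with hh
  have hfin : ∫⁻ x : ℕ, (x : ENNReal) ∂f.toMeasure ≠ ⊤ := by
    rw [lintegral_countable']
    have : ∀ x : ℕ, (x : ENNReal) * f.toMeasure {x} = ENNReal.ofReal ((x : ℝ) * (f x).toReal) := by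
      intro x
      rw [PMF.toMeasure_apply_singleton _ _ (measurableSet_singleton x),
        ENNReal.ofReal_mul (by positivity), ENNReal.ofReal_natCast,
        ENNReal.ofReal_toReal (f.apply_ne_top x)]
    simp only [this]
    exact hf.tsum_ofReal_ne_top
  have hlim : Tendsto (fun M => ∫⁻ x, h M x ∂f.toMeasure) atTop (𝓝 0) := by
    have := tendsto_lintegral_of_dominated_convergence (μ := f.toMeasure) (F := h) (f := fun _ => 0)
      (fun x : ℕ => (x : ENNReal)) (fun _ => Measurable.of_discrete)
      (fun M => ae_of_all _ fun x => by simp only [hh]; split_ifs <;> simp) hfin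
      (ae_of_all _ fun x => by
        refine tendsto_const_nhds.congr' ?_
        filter_upwards [eventually_gt_atTop x] with M hM
        simp [hh, hM])
    simpa using this
  have hpos : 0 < η * ENNReal.ofReal ε :=
    pos_iff_ne_zero.2 (mul_ne_zero hη (ENNReal.ofReal_pos.2 hε).ne')
  obtain ⟨M, hM, hM1⟩ := ((ENNReal.tendsto_nhds_zero.1 hlim _ hpos).and
    (eventually_ge_atTop 1)).exists
  refine ⟨M, hM1, fun n hn => ?_⟩
  have hn' : (0 : ℝ) < n := by exact_mod_cast hn
  have hmeas : ∀ i : Fin n, Measurable fun d : Fin n → ℕ => h M (d i) := fun i =>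
    (Measurable.of_discrete (f := h M)).comp (measurable_pi_apply i)
  have hlint : ∫⁻ d, ∑ i, h M (d i) ∂(Measure.pi fun _ : Fin n => f.toMeasure) =
      n * ∫⁻ x, h M x ∂f.toMeasure := by
    rw [lintegral_finsetSum _ fun i _ => hmeas i]
    have : ∀ i : Fin n, ∫⁻ d, h M (d i) ∂(Measure.pi fun _ : Fin n => f.toMeasure) =
        ∫⁻ x, h M x ∂f.toMeasure := fun i =>
      (measurePreserving_eval (fun _ : Fin n => f.toMeasure) i).lintegral_comp
        (Measurable.of_discrete)
    simp [this]
  have hsub : {d : Fin n → ℕ | ε * n < tailSum M d} ⊆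
      {d | ENNReal.ofReal (ε * n) ≤ ∑ i, h M (d i)} := by
    intro d hd
    change ε * n < tailSum M d at hd
    have hsum : ∑ i, h M (d i) = ENNReal.ofReal (tailSum M d) := by
      rw [tailSum, ENNReal.ofReal_sum_of_nonneg fun i _ => by positivity]
      refine Finset.sum_congr rfl fun i _ => ?_
      simp only [hh]
      split_ifs <;> simp
    change _ ≤ ∑ i, h M (d i)
    rw [hsum]
    exact ENNReal.ofReal_le_ofReal hd.le
  have hne : ENNReal.ofReal (ε * n) ≠ 0 := (ENNReal.ofReal_pos.2 (by positivity)).ne'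
  refine (measure_mono hsub).trans ((meas_ge_le_lintegral_div ?_ hne ENNReal.ofReal_ne_top).trans ?_)
  · exact (Finset.measurable_sum _ fun i _ => hmeas i).aemeasurable
  · rw [hlint]
    refine ENNReal.div_le_of_le_mul ?_
    calc _ ≤ (n : ENNReal) * (η * ENNReal.ofReal ε) := mul_le_mul_right hM _
      _ = _ := by rw [ENNReal.ofReal_mul hε.le, ENNReal.ofReal_natCast]; ring

/-! ### Parity correction, and pairings of a typical degree sequence -/

theorem makeEven_le {n : ℕ} (d : Fin n → ℕ) (i : Fin n) : makeEven d i ≤ d i + 1 := by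
  unfold makeEven
  split_ifs <;> omega

/-- The strict `M <` on the corrected degrees absorbs the extra stub: it forces `M ≤ d i`, and `d i
≥ 1` gives `d i + 1 ≤ 2 * d i`. -/
theorem sum_makeEven_tail_le {n M : ℕ} (hM : 1 ≤ M) (d : Fin n → ℕ) :
    ∑ i, (if M < makeEven d i then (makeEven d i : ℝ) else 0) ≤ 2 * tailSum M d := by
  rw [tailSum, Finset.mul_sum]
  refine Finset.sum_le_sum fun i _ => ?_
  have := makeEven_le d i
  split_ifs with h1 h2
  · exact_mod_cast (by omega : makeEven d i ≤ 2 * d i)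
  · omega
  · positivity
  · simp

theorem countEq_le_makeEven {n : ℕ} (k : ℕ) (d : Fin n → ℕ) :
    countEq k d ≤ countEq k (makeEven d) + 1 := by
  have h1 : ∑ i : Fin n, (if (i : ℕ) + 1 = n then (1 : ℝ) else 0) ≤ 1 := by
    cases n with
    | zero => simp
    | succ m =>
      rw [Finset.sum_eq_single (Fin.last m)]
      · simp
      · intro b _ hb
        rw [if_neg]
        intro h
        exact hb (Fin.ext (by simpa using h))
      · simp
  refine le_trans ?_ (add_le_add_right h1 _)
  rw [countEq, countEq, ← Finset.sum_add_distrib]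
  refine Finset.sum_le_sum fun i _ => ?_
  by_cases hi : (i : ℕ) + 1 = n
  · rw [if_pos hi]
    split_ifs <;> simp
  · have : makeEven d i = d i := by simp [makeEven, hi]
    rw [this]
    simp [hi]

theorem Pairing.countEq_le_stubsAt {n k : ℕ} (hk : 1 ≤ k) {d : Fin n → ℕ} (σ : Pairing d) :
    countEq k d ≤ σ.graph.stubsAt k := by
  refine Finset.sum_le_sum fun i _ => ?_
  rw [Pairing.degree_graph]
  split_ifs with h
  · rw [h]; exact_mod_cast hk
  · rfl

theorem Pairing.erasedMass_le {n : ℕ} {d : Fin n → ℕ} (σ : Pairing d) (M : ℕ) :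
    σ.graph.erasedMass ≤
      ∑ i, (if d i ≤ M ∧ σ.graph.erase.degree i ≠ σ.graph.degree i then (d i : ℝ) else 0) +
        ∑ i, (if M < d i then (d i : ℝ) else 0) := by
  rw [← Finset.sum_add_distrib]
  refine Finset.sum_le_sum fun i _ => ?_
  rw [Pairing.degree_graph]
  by_cases h1 : σ.graph.erase.degree i = d i
  · simp only [h1, if_true]
    positivity
  · by_cases h2 : d i ≤ M
    · simp [h1, h2, not_lt.2 h2]
    · simp [h1, h2, not_le.1 h2]

/-- For degrees with few large entries, erasing changes the rank at `k` in few pairings only. -/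
theorem uniform_pairing_annr_le {n k : ℕ} (hk : 1 ≤ k) {d : Fin n → ℕ} {M K : ℕ} (hM : 1 ≤ M)
    (hK : 1 ≤ K) {c δ ε : ℝ} (hc : 0 < c) (hδ : 0 < δ)
    (hcount : 2 * c * n < countEq k d) (hn : 6 ≤ c * n) (htM : 2 * tailSum M d ≤ δ * c / 10 * n)
    (htK : 2 * tailSum K d ≤ ε * n) (hKn : K ≤ ε * n) :
    (PMF.uniformOfFintype (Pairing (makeEven d))).toOuterMeasure
      {σ | δ < |σ.graph.erase.annr k - σ.graph.annr k|} ≤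
        ENNReal.ofReal (120 * M ^ 2 * ε / (δ * c)) := by
  have hn0 : (0 : ℝ) < n := by
    by_contra h
    have : (n : ℝ) ≤ 0 := not_lt.1 h
    nlinarith
  set D := makeEven d with hD
  have hcD : c * n < countEq k D := by
    have := countEq_le_makeEven k d
    linarith
  have hsum : (Fintype.card (Stub D) : ℝ) = ∑ i, (D i : ℝ) := by simp
  have hL : 6 ≤ Fintype.card (Stub D) := by
    have h : countEq k D ≤ Fintype.card (Stub D) := by
      rw [hsum, countEq]
      refine Finset.sum_le_sum fun i _ => ?_
      split_ifs with h
      · rw [h]; exact_mod_cast hk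
      · positivity
    exact_mod_cast hn.trans (hcD.le.trans h)
  -- A bound on the maximal degree that is at most `2 * ε * n`: a single degree above `K` is at most
  -- the sum of all of them.
  set m : ℕ := K + ∑ i, (if K < D i then D i else 0) with hm
  have hmD : ∀ j, D j ≤ m := by
    intro j
    by_cases hj : K < D j
    · have := Finset.single_le_sum (f := fun i => if K < D i then D i else 0)
        (fun _ _ => Nat.zero_le _) (Finset.mem_univ j)
      simp only [hj, if_true] at this
      omega
    · omega
  have hmε : (m : ℝ) ≤ 2 * ε * n := by
    have := sum_makeEven_tail_le hK d
    rw [hm]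
    push_cast
    linarith
  have hbound := Pairing.sum_erasedMass_truncated_le hmD (by omega) hL M
  have hmain := toOuterMeasure_uniformOfFintype_le (α := Pairing D)
    (fun σ => ∑ i, (if D i ≤ M ∧ σ.graph.erase.degree i ≠ σ.graph.degree i then (D i : ℝ) else 0))
    (fun σ => by positivity) {σ | δ < |σ.graph.erase.annr k - σ.graph.annr k|}
    -- A rank change above `δ` forces `erasedMass > δ * c * n / 5`. Degrees above `M` supply at most
    -- half of this, so the truncated mass exceeds `δ * c * n / 10`.
    (x := δ * c / 10 * n) (b := 6 * M ^ 2 * (2 * ε * n)) (by positivity) ?_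
    (hbound.trans (by gcongr))
  · refine hmain.trans_eq ?_
    congr 1
    field_simp
    ring
  · intro σ hσ
    change δ < |σ.graph.erase.annr k - σ.graph.annr k| at hσ
    have hst : c * n < σ.graph.stubsAt k := hcD.trans_le (σ.countEq_le_stubsAt hk)
    have hpos : 0 < σ.graph.stubsAt k := lt_trans (by positivity) hst
    have h1 := hσ.trans_le (σ.graph.abs_annr_erase_sub_le σ.graph_symm hk hpos)
    rw [lt_div_iff₀ hpos] at h1
    have h2 := σ.erasedMass_le M
    have h3 := sum_makeEven_tail_le hM d
    have h4 : δ * (c * n) < δ * σ.graph.stubsAt k := by gcongr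
    linarith

/-- A positive size-biased probability presupposes a finite mean. A finite mean is all that the
comparison with the erased model requires; regular variation with exponent above one is a
sufficient condition for it. -/
theorem summable_of_sizeBiased_pos {f : PMF ℕ} {k : ℕ} (hk : 0 < sizeBiased f k) :
    Summable fun j : ℕ => (j : ℝ) * (f j).toReal := by
  by_contra h
  have h0 : pmfMean f = 0 := tsum_eq_zero_of_not_summable h
  simp [sizeBiased, h0] at hk

theorem mainTheorem8 (f : PMF ℕ) (γ : ℝ) (hγ : 1 < γ) (hf : RegularlyVarying f γ)
    {Ω : ℕ → Type*} [∀ n, MeasurableSpace (Ω n)]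
    (P : ∀ n, Measure (Ω n)) [∀ n, IsProbabilityMeasure (P n)]
    (G : ∀ n, Ω n → Multigraph n)
    (hG : ∀ n, HasLaw (G n) (configurationModel f n).toMeasure (P n))
    (k : ℕ) (hk : 0 < sizeBiased f k) (δ : ℝ) (hδ : 0 < δ) :
    Tendsto (fun n => P n {ω | δ < |(G n ω).erase.annr k - (G n ω).annr k|})
      atTop (𝓝 0) := by
  have hsummable := summable_of_sizeBiased_pos hk
  have hk1 : 1 ≤ k := by
    by_contra h
    obtain rfl : k = 0 := by omega
    simp [sizeBiased] at hk
  have hfk : 0 < (f k).toReal := by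
    refine ENNReal.toReal_nonneg.lt_of_ne' fun h => ?_
    simp [sizeBiased, h] at hk
  -- Then `2 * c < f k` leaves room for Chebyshev, and passing from `2 * c` to `c` absorbs the
  -- parity correction.
  set c := (f k).toReal / 4 with hc
  have hc0 : 0 < c := by positivity
  rw [ENNReal.tendsto_nhds_zero]
  intro η hη
  -- A finite `r` below the possibly infinite `η`, split into four quarters: three for atypical
  -- degrees, one for the pairing.
  obtain ⟨r, hr0, hr⟩ := ENNReal.lt_iff_exists_nnreal_btwn.1 hη
  have hr0 : 0 < (r : ℝ) := by exact_mod_cast hr0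
  have hq : ENNReal.ofReal (r / 4) ≠ 0 := (ENNReal.ofReal_pos.2 (by positivity)).ne'
  obtain ⟨M, hM1, hM⟩ := exists_measure_tailSum_le f hsummable (ε := δ * c / 20) (by positivity) hq
  have hM0 : (0 : ℝ) < M := by exact_mod_cast hM1
  -- Chosen after `M` so that the bound of `uniform_pairing_annr_le` equals `r / 4`; `K` depends on
  -- `ε` in turn.
  set ε := r / 4 * (δ * c) / (120 * M ^ 2) with hε
  have hε0 : 0 < ε := by positivity
  obtain ⟨K, hK1, hK⟩ := exists_measure_tailSum_le f hsummable (ε := ε / 2) (by positivity) hq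
  have hN := ENNReal.tendsto_nhds_zero.1
    (tendsto_measure_countEq_le f k (c := 2 * c) (by linarith)) _ (pos_iff_ne_zero.2 hq)
  have hlarge : ∀ a x : ℝ, 0 < a → ∀ᶠ n : ℕ in atTop, x ≤ a * n := fun a x ha =>
    (tendsto_natCast_atTop_atTop.const_mul_atTop ha).eventually_ge_atTop x
  filter_upwards [hN, hlarge c 6 hc0, hlarge ε K hε0, eventually_ge_atTop 1] with n h1 h2 h3 h4
  have hB : MeasurableSet {H : Multigraph n | δ < |H.erase.annr k - H.annr k|} :=
    (Set.to_countable _).measurableSet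
  rw [(hG n).measure_eq hB, PMF.toMeasure_apply_eq_toOuterMeasure, configurationModel]
  set A : Set (Fin n → ℕ) := {d | 2 * c * n < countEq k d ∧ tailSum M d ≤ δ * c / 20 * n ∧
    tailSum K d ≤ ε / 2 * n} with hA
  have hbad : (iidLaw f n).toOuterMeasure Aᶜ ≤
      ENNReal.ofReal (r / 4) + ENNReal.ofReal (r / 4) + ENNReal.ofReal (r / 4) := by
    rw [← PMF.toMeasure_apply_eq_toOuterMeasure, iidLaw, Measure.toPMF_toMeasure]
    have hsub : Aᶜ ⊆ ({d | countEq k d ≤ 2 * c * n} ∪ {d | δ * c / 20 * n < tailSum M d}) ∪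
        {d | ε / 2 * n < tailSum K d} := by
      intro d hd
      by_contra hd'
      simp only [Set.mem_union, Set.mem_ofPred_eq, not_or, not_le, not_lt] at hd'
      exact hd ⟨hd'.1.1, hd'.1.2, hd'.2⟩
    exact (measure_mono hsub).trans ((measure_union_le _ _).trans (add_le_add
      ((measure_union_le _ _).trans (add_le_add h1 (hM n h4))) (hK n h4)))
  refine (toOuterMeasure_bind_le _ _ _ A (ε := ENNReal.ofReal (r / 4)) ?_).trans
    ((add_le_add_left hbad _).trans ?_)
  · rintro d ⟨hd1, hd2, hd3⟩
    rw [PMF.toOuterMeasure_map_apply]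
    refine (uniform_pairing_annr_le hk1 hM1 hK1 hc0 hδ hd1 h2 (by linarith) (by linarith)
      h3).trans_eq ?_
    congr 1
    rw [hε]
    field_simp
  · rw [← ENNReal.ofReal_add (by positivity) (by positivity),
      ← ENNReal.ofReal_add (by positivity) (by positivity),
      ← ENNReal.ofReal_add (by positivity) (by positivity)]
    have : (r / 4 + r / 4 + r / 4 + r / 4 : ℝ) = r := by ring
    rw [this, ENNReal.ofReal_coe_nnreal]
    exact hr.le
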